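/- Let $l,w\ge 1$ be integers. For $i\in\{1,2\}$, the hammock network $H^{(i)}_{l,w}$ of kind $i$ and dimensions $(l,w)$ is the following graph. Its nodes are the lattice points $(x,y)\in\mathbb Z^2$ with $0\le x\le l$, $0\le y\le w$ and $x+y$ even (if $i=1$), respectively odd (if $i=2$). Its set of edges $E^{(i)}_{l,w}$ consists of all segments joining two such nodes $(x,y)$, $(x',y')$ with $|x-x'|=|y-y'|=1$; there are exactly $lw$ of them. The source nodes are the nodes with $x=0$, and the terminus nodes are the nodes with $x=l$. An X-path is a sequence $v_0,\dots,v_k$ of pairwise distinct points of $\mathbb Z^2$ with all steps $v_j-v_{j-1}$ in $\{(1,1),(-1,1),(1,-1),(-1,-1)\}$. A pathset is a set $P\subseteq E^{(i)}_{l,w}$ containing all the edges of some X-path from a source node to a terminus node; $\mathcal P^{(i)}_{l,w}$ denotes the set of all pathsets. The two-terminal reliability polynomial of $H^{(i)}_{l,w}$, i.e. the probability that the closed edges form a pathset when the edges are closed independently with probability $p$, is $$h^{(i)}_{l,w}(p)=\sum_{P\in\mathcal P^{(i)}_{l,w}}p^{|P|}(1-p)^{lw-|P|}.$$ Then, for all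 integers $l,w\ge 1$, all $i\in\{1,2\}$ and all $p\in[0,1]$, $$h^{(i)}_{l,w}(p)=1-h^{(2/i)}_{w,l}(1-p),$$ where $2/i$ is the other kind ($2/1=2$, $2/2=1$). -/

import Mathlib

open Polynomial

/-- The two kinds of hammock networks. -/
inductive HammockKind where
  | first
  | second

namespace HammockKind

/-- The other kind (written `2/i` when the kinds are numbered `i = 1, 2`). -/
def other : HammockKind → HammockKind
  | first => second
  | second => first

/-- The lattice points of each kind: `x + y` even for the first kind, odd for the second. -/
def HasPoint : HammockKind → ℤ × ℤ → Prop
  | first, a => Even (a.1 + a.2)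
  | second, a => Odd (a.1 + a.2)

end HammockKind

namespace Hammock

/-- The steps allowed in an `X`-path. -/
def xSteps : Set (ℤ × ℤ) := {(1, 1), (-1, 1), (1, -1), (-1, -1)}

/-- `v 0, …, v k` is an `X`-path: a lattice path with steps in `xSteps` whose points are
pairwise distinct. -/
def IsXPath {k : ℕ} (v : Fin (k + 1) → ℤ × ℤ) : Prop :=
  (∀ j : Fin k, v j.succ - v j.castSucc ∈ xSteps) ∧ Function.Injective v

/-- All lattice points of the rectangle `[0, l] × [0, w]`. -/
noncomputable def box (l w : ℕ) : Finset (ℤ × ℤ) := Finset.Icc 0 (l : ℤ) ×ˢ Finset.Icc 0 (w : ℤ)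

open Classical in
/-- The nodes of the hammock network of kind `i` and dimensions `(l, w)`. -/
noncomputable def nodes (l w : ℕ) (i : HammockKind) : Finset (ℤ × ℤ) :=
  (box l w).filter fun a => i.HasPoint a

open Classical in
/-- The edges of the hammock network of kind `i` and dimensions `(l, w)`: the unordered pairs of
lattice points of the rectangle, of the given kind, which differ by `1` in both coordinates. -/
noncomputable def edges (l w : ℕ) (i : HammockKind) : Finset (Sym2 (ℤ × ℤ)) :=
  ((box l w ×ˢ box l w).filter fun q =>
    |q.1.1 - q.2.1| = 1 ∧ |q.1.2 - q.2.2| = 1 ∧ i.HasPoint q.1).image fun q => s(q.1, q.2)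

/-- The input nodes: the nodes on the side `x = 0`. -/
def IsSource (l w : ℕ) (i : HammockKind) (a : ℤ × ℤ) : Prop := a ∈ nodes l w i ∧ a.1 = 0

/-- The output nodes: the nodes on the side `x = l`. -/
def IsTerminus (l w : ℕ) (i : HammockKind) (a : ℤ × ℤ) : Prop := a ∈ nodes l w i ∧ a.1 = l

/-- A pathset: a set of edges of the network containing (all the edges of) an `X`-path from an
input node to an output node. -/
def IsPathset (l w : ℕ) (i : HammockKind) (P : Finset (Sym2 (ℤ × ℤ))) : Prop :=
  P ⊆ edges l w i ∧
    ∃ (k : ℕ) (v : Fin (k + 1) → ℤ × ℤ), IsXPath v ∧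
      IsSource l w i (v 0) ∧ IsTerminus l w i (v (Fin.last k)) ∧
      ∀ j : Fin k, s(v j.castSucc, v j.succ) ∈ P

open Classical in
/-- The two-terminal reliability polynomial: the probability, as a polynomial in `p = X`, that the
closed edges form a pathset, when the edges are independently closed with probability `p`.
The exponents of `X` and `1 - X` are the numbers of closed and of open edges. -/
noncomputable def reliability (l w : ℕ) (i : HammockKind) : ℝ[X] :=
  ∑ P ∈ (edges l w i).powerset.filter (fun P => IsPathset l w i P),
    X ^ P.card * (1 - X) ^ (edges l w i \ P).card

end Hammock

/-! Every unit cell of the rectangle has one diagonal of each kind, so an edge set of either kind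
amounts to a set `C` of cells (`edges_eq_image`). The theorem rests on a planar duality,
`crossesVertically_sdiff_iff`: either the diagonals of kind `i` in `C` cross from left to right, or
the diagonals of the other kind in the complement of `C` cross from bottom to top, and never both.
Transposition keeps the kind and turns the second event into a pathset of the `(w, l)` network;
complementation exchanges `p` and `1 - p`; and the weights of all sets `C` add up to `(p + (1 - p))
^ (l * w) = 1`.

Both halves of the duality are counts modulo 2, which replace any appeal to the topology of the
plane. -/

namespace HammockKind

/-- The parity of `x + y` at the lattice points of a given kind. -/
def parity : HammockKind → ℤ
  | first => 0
  | second => 1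

lemma hasPoint_iff (i : HammockKind) (a : ℤ × ℤ) :
    i.HasPoint a ↔ (a.1 + a.2) % 2 = i.parity := by
  cases i
  · exact Int.even_iff
  · exact Int.odd_iff

lemma parity_eq (i : HammockKind) : i.parity = 0 ∨ i.parity = 1 := by
  cases i <;> simp [parity]

lemma parity_other (i : HammockKind) : i.other.parity = 1 - i.parity := by
  cases i <;> simp [parity, other]

lemma hasPoint_swap (i : HammockKind) (a : ℤ × ℤ) : i.HasPoint a.swap ↔ i.HasPoint a := by
  simp [hasPoint_iff, add_comm]

lemma hasPoint_other (i : HammockKind) (a : ℤ × ℤ) : i.other.HasPoint a ↔ ¬ i.HasPoint a := by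
  have := i.parity_eq
  rw [hasPoint_iff, hasPoint_iff, parity_other]
  omega

end HammockKind

/-! ### Edges as diagonals of cells -/

namespace Hammock

/-- The unit squares of the rectangle `[0, l] × [0, w]`, named by their lower left corners. -/
noncomputable def cells (l w : ℕ) : Finset (ℤ × ℤ) := Finset.Ico 0 (l : ℤ) ×ˢ Finset.Ico 0 (w : ℤ)

lemma mem_cells {l w : ℕ} {c : ℤ × ℤ} :
    c ∈ cells l w ↔ (0 ≤ c.1 ∧ c.1 < l) ∧ (0 ≤ c.2 ∧ c.2 < w) := by
  simp [cells]

open Classical in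
/-- The lower end of the diagonal of kind `i` of the cell `c`. -/
noncomputable def lo (i : HammockKind) (c : ℤ × ℤ) : ℤ × ℤ :=
  if i.HasPoint c then c else (c.1 + 1, c.2)

open Classical in
/-- The upper end of the diagonal of kind `i` of the cell `c`. -/
noncomputable def hi (i : HammockKind) (c : ℤ × ℤ) : ℤ × ℤ :=
  if i.HasPoint c then (c.1 + 1, c.2 + 1) else (c.1, c.2 + 1)

/-- The diagonal of kind `i` of the cell `c`. -/
noncomputable def diag (i : HammockKind) (c : ℤ × ℤ) : Sym2 (ℤ × ℤ) := s(lo i c, hi i c)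

lemma lo_hi_cases (i : HammockKind) (c : ℤ × ℤ) :
    (i.HasPoint c ∧ lo i c = c ∧ hi i c = (c.1 + 1, c.2 + 1)) ∨
      (¬ i.HasPoint c ∧ lo i c = (c.1 + 1, c.2) ∧ hi i c = (c.1, c.2 + 1)) := by
  by_cases h : i.HasPoint c <;> simp [lo, hi, h]

lemma hasPoint_lo (i : HammockKind) (c : ℤ × ℤ) : i.HasPoint (lo i c) := by
  have := i.parity_eq
  obtain ⟨h, h1, -⟩ | ⟨h, h1, -⟩ := lo_hi_cases i c
  · rwa [h1]
  · rw [h1]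
    rw [i.hasPoint_iff] at h ⊢
    simp only
    omega

lemma hasPoint_hi (i : HammockKind) (c : ℤ × ℤ) : i.HasPoint (hi i c) := by
  have := i.parity_eq
  obtain ⟨h, -, h1⟩ | ⟨h, -, h1⟩ := lo_hi_cases i c <;>
  · rw [h1]
    rw [i.hasPoint_iff] at h ⊢
    simp only
    omega

lemma diag_injective (i : HammockKind) : Function.Injective (diag i) := by
  rintro ⟨x, y⟩ ⟨x', y'⟩ h
  have := i.parity_eq
  obtain ⟨h1, h2, h3⟩ | ⟨h1, h2, h3⟩ := lo_hi_cases i (x, y) <;>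
  obtain ⟨h1', h2', h3'⟩ | ⟨h1', h2', h3'⟩ := lo_hi_cases i (x', y') <;>
  · simp only [diag, h2, h3, h2', h3', Sym2.eq_iff, Prod.mk.injEq, i.hasPoint_iff] at *
    omega

lemma edges_eq_image (l w : ℕ) (i : HammockKind) : edges l w i = (cells l w).image (diag i) := by
  have := i.parity_eq
  ext e
  induction e using Sym2.ind with
  | _ a b =>
  obtain ⟨x, y⟩ := a
  obtain ⟨x', y'⟩ := b
  simp only [edges, box, Finset.mem_image, Finset.mem_filter, Finset.mem_product, Finset.mem_Icc]
  constructor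
  · rintro ⟨⟨⟨x, y⟩, ⟨x', y'⟩⟩, ⟨hb, h1, h2, hp⟩, he⟩
    rw [← he]
    simp only at hb h1 h2 hp
    rw [i.hasPoint_iff] at hp
    simp only at hp
    -- `(u, v)` is the lower left corner of the cell spanned by the edge.
    have key : ∀ u v : ℤ, (u, v) ∈ cells l w → (u = x ∧ x' = x + 1 ∨ u = x' ∧ x = x' + 1) →
        (v = y ∧ y' = y + 1 ∨ v = y' ∧ y = y' + 1) →
        ∃ c ∈ cells l w, diag i c = s((x, y), (x', y')) := by
      intro u v hc hu hv
      refine ⟨_, hc, ?_⟩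
      obtain ⟨h1', h2', h3'⟩ | ⟨h1', h2', h3'⟩ := lo_hi_cases i (u, v) <;>
      · simp only [diag, h2', h3', Sym2.eq_iff, Prod.mk.injEq, i.hasPoint_iff] at *
        omega
    obtain hx | hx := (abs_eq zero_le_one).1 h1 <;> obtain hy | hy := (abs_eq zero_le_one).1 h2
    on_goal 1 => refine key x' y' (mem_cells.2 ?_) ?_ ?_
    on_goal 4 => refine key x' y (mem_cells.2 ?_) ?_ ?_
    on_goal 7 => refine key x y' (mem_cells.2 ?_) ?_ ?_
    on_goal 10 => refine key x y (mem_cells.2 ?_) ?_ ?_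
    all_goals omega
  · rintro ⟨c, hc, he⟩
    rw [mem_cells] at hc
    refine ⟨(lo i c, hi i c), ⟨?_, ?_, ?_, hasPoint_lo i c⟩, he⟩ <;>
    obtain ⟨h1, h2, h3⟩ | ⟨h1, h2, h3⟩ := lo_hi_cases i c <;>
    · simp only [h2, h3]
      first | omega | simp

/-! ### Pathsets as crossings -/

/-- The points `a` and `b` are joined by the diagonal of kind `i` of a cell of `C`. -/
def Step (i : HammockKind) (C : Finset (ℤ × ℤ)) (a b : ℤ × ℤ) : Prop := ∃ c ∈ C, diag i c = s(a, b)

lemma Step.symm {i : HammockKind} {C : Finset (ℤ × ℤ)} {a b : ℤ × ℤ} (h : Step i C a b) :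
    Step i C b a := by
  obtain ⟨c, hc, h⟩ := h
  exact ⟨c, hc, h.trans Sym2.eq_swap⟩

/-- The diagonals of kind `i` of the cells of `C` connect the left side to the right side. -/
def Crosses (l w : ℕ) (i : HammockKind) (C : Finset (ℤ × ℤ)) : Prop :=
  ∃ a b, IsSource l w i a ∧ IsTerminus l w i b ∧ Relation.ReflTransGen (Step i C) a b

lemma Step.sub_mem_xSteps {i : HammockKind} {C : Finset (ℤ × ℤ)} {a b : ℤ × ℤ}
    (h : Step i C a b) : b - a ∈ xSteps := by
  obtain ⟨c, -, h⟩ := h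
  obtain ⟨h1, h2, h3⟩ | ⟨h1, h2, h3⟩ := lo_hi_cases i c <;>
  · rw [diag, h2, h3, Sym2.eq_iff] at h
    obtain ⟨rfl, rfl⟩ | ⟨rfl, rfl⟩ := h <;> simp [xSteps, Prod.ext_iff]

lemma isPathset_image_iff {l w : ℕ} {i : HammockKind} {C : Finset (ℤ × ℤ)} (hC : C ⊆ cells l w) :
    IsPathset l w i (C.image (diag i)) ↔ Crosses l w i C := by
  constructor
  · rintro ⟨-, k, v, -, hs, ht, hv⟩
    refine ⟨_, _, hs, ht, ?_⟩
    have key : ∀ j : Fin (k + 1), Relation.ReflTransGen (Step i C) (v 0) (v j) := by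
      intro j
      induction j using Fin.induction with
      | zero => exact .refl
      | succ j ih => exact ih.tail (by simpa [Step] using hv j)
    exact key _
  · rintro ⟨a, b, ha, hb, h⟩
    refine ⟨edges_eq_image l w i ▸ Finset.image_subset_image hC, ?_⟩
    -- A chain of steps may revisit points; shortening it to a path in this graph makes them
    -- distinct.
    let G : SimpleGraph (ℤ × ℤ) :=
      { Adj := Step i C
        symm := ⟨fun _ _ h => h.symm⟩
        loopless := ⟨fun _ h => by simpa [xSteps, Prod.ext_iff] using h.sub_mem_xSteps⟩ }
    have hr : G.Reachable a b := (G.reachable_iff_reflTransGen a b).2 h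
    obtain ⟨p, hp⟩ := hr.exists_isPath
    refine ⟨p.length, fun j => p.getVert j, ⟨fun j => ?_, ?_⟩, by simpa using ha,
      by simpa using hb, fun j => ?_⟩
    · have : Step i C _ _ := p.adj_getVert_succ j.2
      simpa using this.sub_mem_xSteps
    · intro j j' hj
      exact Fin.ext (hp.getVert_injOn (by simpa using Nat.le_of_lt_succ j.2)
        (by simpa using Nat.le_of_lt_succ j'.2) hj)
    · have : Step i C _ _ := p.adj_getVert_succ j.2
      simpa [Step] using this

lemma reliability_eval (l w : ℕ) (i : HammockKind) (p : ℝ) [DecidablePred (Crosses l w i)] :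
    (reliability l w i).eval p =
      ∑ C ∈ (cells l w).powerset with Crosses l w i C,
        p ^ C.card * (1 - p) ^ (cells l w \ C).card := by
  classical
  simp only [reliability, eval_finsetSum, eval_mul, eval_pow, eval_X, eval_sub, eval_one]
  symm
  refine Finset.sum_bij (fun C _ => C.image (diag i)) ?_ ?_ ?_ ?_
  · intro C hC
    simp only [Finset.mem_filter, Finset.mem_powerset] at hC ⊢
    exact ⟨edges_eq_image l w i ▸ Finset.image_subset_image hC.1, (isPathset_image_iff hC.1).2 hC.2⟩
  · intro C _ C' _ h
    exact Finset.image_injective (diag_injective i) h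
  · intro P hP
    simp only [Finset.mem_filter, Finset.mem_powerset] at hP
    obtain ⟨h1, h2⟩ := hP
    rw [edges_eq_image, Finset.subset_image_iff] at h1
    obtain ⟨C, hC, rfl⟩ := h1
    exact ⟨C, by simpa [hC] using (isPathset_image_iff (by simpa using hC)).1 h2, rfl⟩
  · intro C _
    rw [edges_eq_image, ← Finset.image_sdiff _ _ (diag_injective i),
      Finset.card_image_of_injective _ (diag_injective i),
      Finset.card_image_of_injective _ (diag_injective i)]

/-! ### Vertical crossings and transposition -/

/-- The diagonals of kind `i` of the cells of `C` connect the bottom side to the top side. -/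
def CrossesVertically (l w : ℕ) (i : HammockKind) (C : Finset (ℤ × ℤ)) : Prop :=
  ∃ a ∈ nodes l w i, ∃ b ∈ nodes l w i, a.2 = 0 ∧ b.2 = w ∧ Relation.ReflTransGen (Step i C) a b

lemma Step.swap {i : HammockKind} {C : Finset (ℤ × ℤ)} {a b : ℤ × ℤ} (h : Step i C a b) :
    Step i (C.image Prod.swap) a.swap b.swap := by
  obtain ⟨c, hc, h⟩ := h
  refine ⟨c.swap, Finset.mem_image_of_mem _ hc, ?_⟩
  have := i.hasPoint_swap c
  obtain ⟨h1, h2, h3⟩ | ⟨h1, h2, h3⟩ := lo_hi_cases i c <;>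
  obtain ⟨h1', h2', h3'⟩ | ⟨h1', h2', h3'⟩ := lo_hi_cases i c.swap <;>
  first
  | exact absurd (this.1 h1') h1
  | exact absurd (this.2 h1) h1'
  | rw [diag, h2, h3, Sym2.eq_iff] at h
    rw [diag, h2', h3', Sym2.eq_iff]
    obtain ⟨rfl, rfl⟩ | ⟨rfl, rfl⟩ := h <;> simp

lemma swap_mem_nodes {l w : ℕ} {i : HammockKind} {a : ℤ × ℤ} :
    a.swap ∈ nodes w l i ↔ a ∈ nodes l w i := by
  simp only [nodes, box, Finset.mem_filter, Finset.mem_product, i.hasPoint_swap]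
  simp [and_comm]

lemma image_swap_image_swap (C : Finset (ℤ × ℤ)) : (C.image Prod.swap).image Prod.swap = C := by
  simp [Finset.image_image]

lemma crosses_image_swap_iff {l w : ℕ} {i : HammockKind} {C : Finset (ℤ × ℤ)} :
    Crosses w l i (C.image Prod.swap) ↔ CrossesVertically l w i C := by
  constructor
  · rintro ⟨a, b, ⟨ha, ha'⟩, ⟨hb, hb'⟩, h⟩
    refine ⟨a.swap, swap_mem_nodes.2 ha, b.swap, swap_mem_nodes.2 hb, ha', hb', ?_⟩
    exact h.lift Prod.swap fun a b h => by simpa [image_swap_image_swap] using h.swap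
  · rintro ⟨a, ha, b, hb, ha', hb', h⟩
    exact ⟨a.swap, b.swap, ⟨swap_mem_nodes.2 ha, ha'⟩, ⟨swap_mem_nodes.2 hb, hb'⟩,
      h.lift Prod.swap fun a b h => h.swap⟩

/-! ### At least one crossing exists -/

lemma mem_nodes {l w : ℕ} {i : HammockKind} {a : ℤ × ℤ} :
    a ∈ nodes l w i ↔ ((0 ≤ a.1 ∧ a.1 ≤ l) ∧ (0 ≤ a.2 ∧ a.2 ≤ w)) ∧ i.HasPoint a := by
  simp [nodes, box]

lemma sum_cells (l w : ℕ) (f : ℤ × ℤ → ZMod 2) :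
    ∑ c ∈ cells l w, f c = ∑ x ∈ Finset.range l, ∑ y ∈ Finset.range w, f (x, y) := by
  have h : ∀ n : ℕ, Finset.Ico 0 (n : ℤ) = (Finset.range n).map Nat.castEmbedding := by
    intro n
    ext z
    simp only [Finset.mem_Ico, Finset.mem_map, Finset.mem_range, Nat.castEmbedding_apply]
    constructor
    · rintro ⟨h1, h2⟩
      exact ⟨z.toNat, by omega, by omega⟩
    · rintro ⟨m, hm, rfl⟩
      omega
  rw [cells, Finset.sum_product, h, h, Finset.sum_map]
  simp

lemma sum_range_add_succ (f : ℕ → ZMod 2) (n : ℕ) :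
    ∑ k ∈ Finset.range n, (f k + f (k + 1)) = f 0 + f n := by
  have := Finset.sum_range_sub f n
  simp only [CharTwo.sub_eq_add] at this
  rw [add_comm (f 0), ← this]
  exact Finset.sum_congr rfl fun _ _ => add_comm _ _

/-- Expressing a sum over the cells by a sum over the sides of the rectangle. -/
lemma sum_cells_jump_mul_jump (l w : ℕ) (F : ℤ × ℤ → ZMod 2) :
    ∑ c ∈ cells l w, (F c + F (c.1 + 1, c.2 + 1)) * (F (c.1 + 1, c.2) + F (c.1, c.2 + 1)) =
      (∑ x ∈ Finset.range l, F (x, 0) * F (x + 1, 0) +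
        ∑ x ∈ Finset.range l, F (x, w) * F (x + 1, w)) +
      (∑ y ∈ Finset.range w, F (0, y) * F (0, y + 1) +
        ∑ y ∈ Finset.range w, F (l, y) * F (l, y + 1)) := by
  -- The product expands over the four sides of the cell; a side interior to the rectangle lies in
  -- two cells and cancels.
  have h1 : ∀ c : ℤ × ℤ, (F c + F (c.1 + 1, c.2 + 1)) * (F (c.1 + 1, c.2) + F (c.1, c.2 + 1)) =
      (F (c.1, c.2) * F (c.1 + 1, c.2) + F (c.1, c.2 + 1) * F (c.1 + 1, c.2 + 1)) +
      (F (c.1, c.2) * F (c.1, c.2 + 1) + F (c.1 + 1, c.2) * F (c.1 + 1, c.2 + 1)) := by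
    intro c; ring
  simp only [h1, Finset.sum_add_distrib (f := fun c : ℤ × ℤ =>
    F (c.1, c.2) * F (c.1 + 1, c.2) + F (c.1, c.2 + 1) * F (c.1 + 1, c.2 + 1))]
  congr 1
  · rw [sum_cells, ← Finset.sum_add_distrib]
    refine Finset.sum_congr rfl fun x _ => ?_
    simpa using sum_range_add_succ (fun y => F (x, y) * F (x + 1, y)) w
  · rw [sum_cells, Finset.sum_comm, ← Finset.sum_add_distrib]
    refine Finset.sum_congr rfl fun y _ => ?_
    simpa using sum_range_add_succ (fun x => F (x, y) * F (x, y + 1)) l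

lemma jump_mul_jump (i : HammockKind) (F : ℤ × ℤ → ZMod 2) (c : ℤ × ℤ) :
    (F c + F (c.1 + 1, c.2 + 1)) * (F (c.1 + 1, c.2) + F (c.1, c.2 + 1)) =
      (F (lo i c) + F (hi i c)) * (F (lo i.other c) + F (hi i.other c)) := by
  by_cases h : i.HasPoint c
  · have h' : ¬ i.other.HasPoint c := by simpa [i.hasPoint_other] using h
    simp [lo, hi, h, h']
  · have h' : i.other.HasPoint c := by simpa [i.hasPoint_other] using h
    simp [lo, hi, h, h', mul_comm]

lemma diag_mem_nodes {l w : ℕ} (i : HammockKind) {c : ℤ × ℤ} (hc : c ∈ cells l w) :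
    lo i c ∈ nodes l w i ∧ hi i c ∈ nodes l w i := by
  rw [mem_cells] at hc
  simp only [mem_nodes, hasPoint_lo, hasPoint_hi, and_true]
  obtain ⟨-, h2, h3⟩ | ⟨-, h2, h3⟩ := lo_hi_cases i c <;>
  · simp only [h2, h3]
    omega

/-- Let `F` indicate reachability from the left at points of kind `i`, and from the bottom at the
others. Each cell has a usable diagonal, along which `F` does not jump, so the product of its two
jumps vanishes. The sum of these products reduces to the sides of the rectangle, where the absence
of both crossings forces it to be 1. -/
theorem crosses_or_crossesVertically (l w : ℕ) (i : HammockKind) (C : Finset (ℤ × ℤ)) :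
    Crosses l w i C ∨ CrossesVertically l w i.other (cells l w \ C) := by
  classical
  by_contra! hcon
  obtain ⟨hi', hj'⟩ := hcon
  let A : ℤ × ℤ → Prop := fun v => ∃ a, IsSource l w i a ∧ Relation.ReflTransGen (Step i C) a v
  let B : ℤ × ℤ → Prop := fun v => ∃ a ∈ nodes l w i.other, a.2 = 0 ∧
    Relation.ReflTransGen (Step i.other (cells l w \ C)) a v
  let F : ℤ × ℤ → ZMod 2 := fun v => if i.HasPoint v then (if A v then 1 else 0)
    else (if B v then 1 else 0)
  have hsum := sum_cells_jump_mul_jump l w F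
  have hzero : ∑ c ∈ cells l w,
      (F c + F (c.1 + 1, c.2 + 1)) * (F (c.1 + 1, c.2) + F (c.1, c.2 + 1)) = 0 := by
    refine Finset.sum_eq_zero fun c hc => ?_
    rw [jump_mul_jump i]
    by_cases hC : c ∈ C
    · have h1 : F (lo i c) = F (hi i c) := by
        have : A (lo i c) ↔ A (hi i c) :=
          ⟨fun ⟨a, h, h'⟩ => ⟨a, h, h'.tail ⟨c, hC, rfl⟩⟩,
            fun ⟨a, h, h'⟩ => ⟨a, h, h'.tail (Step.symm ⟨c, hC, rfl⟩)⟩⟩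
        simp [F, hasPoint_lo, hasPoint_hi, this]
      rw [h1, CharTwo.add_self_eq_zero, zero_mul]
    · have h1 : F (lo i.other c) = F (hi i.other c) := by
        have hD : c ∈ cells l w \ C := Finset.mem_sdiff.2 ⟨hc, hC⟩
        have : B (lo i.other c) ↔ B (hi i.other c) :=
          ⟨fun ⟨a, h, h0, h'⟩ => ⟨a, h, h0, h'.tail ⟨c, hD, rfl⟩⟩,
            fun ⟨a, h, h0, h'⟩ => ⟨a, h, h0, h'.tail (Step.symm ⟨c, hD, rfl⟩)⟩⟩
        simp [F, (i.hasPoint_other _).1 (hasPoint_lo i.other c),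
          (i.hasPoint_other _).1 (hasPoint_hi i.other c), this]
      rw [h1, CharTwo.add_self_eq_zero, mul_zero]
  have hleft : ∀ y : ℤ, 0 ≤ y → y ≤ w → i.HasPoint (0, y) → F (0, y) = 1 := by
    intro y h0 h1 h
    have : A (0, y) := ⟨_, ⟨mem_nodes.2 ⟨by simp only; omega, h⟩, rfl⟩, .refl⟩
    simp [F, h, this]
  have hright : ∀ y : ℤ, 0 ≤ y → y ≤ w → i.HasPoint (l, y) → F (l, y) = 0 := by
    intro y h0 h1 h
    have : ¬ A (l, y) := fun ⟨a, ha, h'⟩ =>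
      hi' ⟨a, _, ha, ⟨mem_nodes.2 ⟨by simp only; omega, h⟩, rfl⟩, h'⟩
    simp [F, h, this]
  have hbot : ∀ x : ℤ, 0 ≤ x → x ≤ l → ¬ i.HasPoint (x, 0) → F (x, 0) = 1 := by
    intro x h0 h1 h
    have : B (x, 0) :=
      ⟨_, mem_nodes.2 ⟨by simp only; omega, (i.hasPoint_other _).2 h⟩, rfl, .refl⟩
    simp [F, h, this]
  have htop : ∀ x : ℤ, 0 ≤ x → x ≤ l → ¬ i.HasPoint (x, w) → F (x, w) = 0 := by
    intro x h0 h1 h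
    have : ¬ B (x, w) := fun ⟨a, ha, h0', h'⟩ =>
      hj' ⟨a, ha, _, mem_nodes.2 ⟨by simp only; omega, (i.hasPoint_other _).2 h⟩, h0', rfl, h'⟩
    simp [F, h, this]
  have hx : ∀ x y : ℤ, i.HasPoint (x + 1, y) ↔ ¬ i.HasPoint (x, y) := by
    intro x y
    have := i.parity_eq
    simp only [i.hasPoint_iff]
    omega
  have hy : ∀ x y : ℤ, i.HasPoint (x, y + 1) ↔ ¬ i.HasPoint (x, y) := by
    intro x y
    have := i.parity_eq
    simp only [i.hasPoint_iff]
    omega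
  have h_top : ∑ x ∈ Finset.range l, F (x, w) * F (x + 1, w) = 0 := by
    refine Finset.sum_eq_zero fun x hxl => ?_
    rw [Finset.mem_range] at hxl
    by_cases h : i.HasPoint ((x : ℤ), (w : ℤ))
    · rw [htop (x + 1) (by omega) (by omega) (by simpa [hx] using h), mul_zero]
    · rw [htop x (by omega) (by omega) h, zero_mul]
  have h_right : ∑ y ∈ Finset.range w, F (l, y) * F (l, y + 1) = 0 := by
    refine Finset.sum_eq_zero fun y hyw => ?_
    rw [Finset.mem_range] at hyw
    by_cases h : i.HasPoint ((l : ℤ), (y : ℤ))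
    · rw [hright y (by omega) (by omega) h, zero_mul]
    · rw [hright (y + 1) (by omega) (by omega) (by simpa [hy] using h), mul_zero]
  have h_bot : ∑ x ∈ Finset.range l, F (x, 0) * F (x + 1, 0) =
      if i.HasPoint (0, 0) then 1 else 0 := by
    -- One endpoint is of the other kind and has value 1, so the product is the value at the
    -- endpoint of kind `i`. Extension by 0 makes the sum telescope to the corners.
    have : ∀ x ∈ Finset.range l, F (x, 0) * F (x + 1, 0) =
        (if i.HasPoint (((x : ℕ) : ℤ), 0) then F ((x : ℕ), 0) else 0) +
          (if i.HasPoint (((x + 1 : ℕ) : ℤ), 0) then F ((x + 1 : ℕ), 0) else 0) := by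
      intro x hxl
      rw [Finset.mem_range] at hxl
      push_cast
      by_cases h : i.HasPoint ((x : ℤ), 0)
      · rw [hbot (x + 1) (by omega) (by omega) (by simpa [hx] using h)]
        simp [hx, h]
      · rw [hbot x (by omega) (by omega) h]
        simp [hx, h]
    rw [Finset.sum_congr rfl this,
      sum_range_add_succ (fun x => if i.HasPoint ((x : ℤ), 0) then F (x, 0) else 0)]
    have h1 : (if i.HasPoint ((l : ℤ), 0) then F (l, 0) else 0) = 0 := by
      split_ifs with h
      · exact hright 0 le_rfl (by omega) h
      · rfl
    rw [h1, add_zero]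
    by_cases h : i.HasPoint (0, 0)
    · simpa [h] using hleft 0 le_rfl (by omega) h
    · simp [h]
  have h_left : ∑ y ∈ Finset.range w, F (0, y) * F (0, y + 1) =
      if i.HasPoint (0, 0) then 0 else 1 := by
    have : ∀ y ∈ Finset.range w, F (0, y) * F (0, y + 1) =
        (if i.HasPoint (0, ((y : ℕ) : ℤ)) then 0 else F (0, (y : ℕ))) +
          (if i.HasPoint (0, ((y + 1 : ℕ) : ℤ)) then 0 else F (0, (y + 1 : ℕ))) := by
      intro y hyw
      rw [Finset.mem_range] at hyw
      push_cast
      by_cases h : i.HasPoint (0, (y : ℤ))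
      · rw [hleft y (by omega) (by omega) h]
        simp [hy, h]
      · rw [hleft (y + 1) (by omega) (by omega) (by simpa [hy] using h)]
        simp [hy, h]
    rw [Finset.sum_congr rfl this,
      sum_range_add_succ (fun y => if i.HasPoint (0, (y : ℤ)) then 0 else F (0, y))]
    have h1 : (if i.HasPoint (0, (w : ℤ)) then 0 else F (0, w)) = 0 := by
      split_ifs with h
      · rfl
      · exact htop 0 le_rfl (by omega) h
    rw [h1, add_zero]
    by_cases h : i.HasPoint (0, 0)
    · simp [h]
    · simpa [h] using hbot 0 le_rfl (by omega) h
  rw [hzero, h_top, h_right, h_bot, h_left] at hsum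
  -- Whichever kind the corner `(0, 0)` has, exactly one of the bottom and left sums is 1.
  split_ifs at hsum <;> simp at hsum

/-! ### The two crossings exclude each other -/

/-- The number of uses of each cell by a path, modulo two. -/
lemma exists_cell_count {i : HammockKind} {D : Finset (ℤ × ℤ)} {a b : ℤ × ℤ}
    (h : Relation.ReflTransGen (Step i D) a b) :
    ∃ n : ℤ × ℤ → ZMod 2, ∀ φ : ℤ × ℤ → ZMod 2,
      ∑ c ∈ D, n c * (φ (lo i c) + φ (hi i c)) = φ a + φ b := by
  classical
  induction h with
  | refl => exact ⟨0, fun φ => by simp [CharTwo.add_self_eq_zero]⟩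
  | @tail b b' _ hs ih =>
    obtain ⟨n, hn⟩ := ih
    obtain ⟨c, hc, h⟩ := hs
    refine ⟨fun x => n x + if x = c then 1 else 0, fun φ => ?_⟩
    have h1 : φ (lo i c) + φ (hi i c) = φ b + φ b' := by
      rw [diag, Sym2.eq_iff] at h
      obtain ⟨h1, h2⟩ | ⟨h1, h2⟩ := h
      · rw [h1, h2]
      · rw [h1, h2, add_comm]
    simp only [add_mul, Finset.sum_add_distrib, hn, ite_mul, one_mul, zero_mul,
      Finset.sum_ite_eq', hc, if_true, h1]
    linear_combination φ b * (CharTwo.two_eq_zero (R := ZMod 2))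

/-- Along the horizontal crossing, count modulo 2 the uses by the vertical one of cells further left
in an adjacent row. The count starts at 0 and cannot change, as the crossings share no cell; but at
the right side it is 1. -/
theorem not_crosses_of_crossesVertically {l w : ℕ} (hw : 1 ≤ w)
    {i : HammockKind} {C : Finset (ℤ × ℤ)} (hC : C ⊆ cells l w)
    (hv : CrossesVertically l w i.other (cells l w \ C)) : ¬ Crosses l w i C := by
  classical
  rintro ⟨a, b, ⟨ha, ha0⟩, ⟨hb, hbl⟩, hab⟩
  obtain ⟨a', ha', b', hb', ha0', hbw', hab'⟩ := hv
  obtain ⟨n, hn⟩ := exists_cell_count hab'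
  set D := cells l w \ C with hD
  let G : ℤ → ℤ → ZMod 2 := fun r x => ∑ c ∈ D, n c * if c.2 = r ∧ c.1 < x then 1 else 0
  have hG0 : ∀ r, G r 0 = 0 := by
    intro r
    refine Finset.sum_eq_zero fun c hc => ?_
    have := mem_cells.1 (Finset.mem_sdiff.1 hc).1
    rw [if_neg (by omega), mul_zero]
  have hGl : ∀ r : ℤ, 0 ≤ r → r < w → G r l = 1 := by
    intro r h0 h1
    -- Only cells of row `r` have a diagonal leaving this half-plane.
    have := hn fun v => if v.2 ≤ r then 1 else 0
    rw [ha0', hbw', if_pos h0, if_neg (by omega), add_zero] at this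
    rw [← this]
    refine Finset.sum_congr rfl fun c hc => ?_
    have hc' := mem_cells.1 (Finset.mem_sdiff.1 hc).1
    congr 1
    obtain ⟨-, h2, h3⟩ | ⟨-, h2, h3⟩ := lo_hi_cases i.other c <;>
    · simp only [h2, h3]
      split_ifs <;> first | omega | simp | exact (CharTwo.add_self_eq_zero _).symm
  have hGrow : ∀ x y : ℤ, i.HasPoint (x, y) → 0 < y → y < w → G (y - 1) x = G y x := by
    intro x y hxy h0 h1
    rw [← CharTwo.add_eq_zero]
    -- As `(x, y)` has kind `i`, each cell left of `x` in the two rows touching height `y` has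
    -- exactly one diagonal end in this set, and no other cell has any.
    have := hn fun v => if v.2 = y ∧ v.1 < x then 1 else 0
    rw [if_neg (by omega), if_neg (by omega), add_zero] at this
    rw [← this, ← Finset.sum_add_distrib]
    refine Finset.sum_congr rfl fun c hc => ?_
    rw [← mul_add]
    congr 1
    have hp := i.parity_eq
    rw [i.hasPoint_iff] at hxy
    simp only at hxy
    obtain ⟨h4, h2, h3⟩ | ⟨h4, h2, h3⟩ := lo_hi_cases i.other c <;>
    · simp only [h2, h3]
      rw [i.other.hasPoint_iff, i.parity_other] at h4
      split_ifs <;> first | omega | simp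
  have key : ∀ v, Relation.ReflTransGen (Step i C) a v → v ∈ nodes l w i ∧
      ∀ r : ℤ, 0 ≤ r → r < w → (r = v.2 ∨ r = v.2 - 1) → G r v.1 = 0 := by
    intro v hv
    induction hv with
    | refl => exact ⟨ha, fun r _ _ _ => by rw [ha0, hG0]⟩
    | @tail u v _ hs ih =>
      obtain ⟨c, hc, h⟩ := hs
      have hcl := mem_cells.1 (hC hc)
      have hn := diag_mem_nodes i (hC hc)
      have hcell : G c.2 (c.1 + 1) = G c.2 c.1 := by
        refine Finset.sum_congr rfl fun d hd => ?_
        have : d ≠ c := fun h => (Finset.mem_sdiff.1 hd).2 (h ▸ hc)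
        rw [Ne, Prod.ext_iff] at this
        congr 1
        split_ifs <;> first | omega | rfl
      have huv : v ∈ nodes l w i ∧ (c.2 = u.2 ∨ c.2 = u.2 - 1) ∧ (c.2 = v.2 ∨ c.2 = v.2 - 1) ∧
          G c.2 u.1 = G c.2 v.1 := by
        rw [diag, Sym2.eq_iff] at h
        obtain ⟨-, h2, h3⟩ | ⟨-, h2, h3⟩ := lo_hi_cases i c <;>
        obtain ⟨h5, h6⟩ | ⟨h5, h6⟩ := h <;>
        · rw [h5, h6] at hn
          refine ⟨by first | exact hn.1 | exact hn.2, ?_⟩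
          rw [← h5, ← h6, h2, h3]
          simp [hcell]
      obtain ⟨hv, hu1, hv1, hG⟩ := huv
      have h0 : G c.2 v.1 = 0 := hG ▸ ih.2 c.2 hcl.2.1 hcl.2.2 hu1
      refine ⟨hv, fun r hr0 hrw hr => ?_⟩
      have hv' := mem_nodes.1 hv
      by_cases hrc : r = c.2
      · rw [hrc, h0]
      -- Here `r` and `c.2` are the two rows on either side of `v`, so `v` is at an interior height.
      · have := hGrow v.1 v.2 hv'.2 (by omega) (by omega)
        obtain hr | hr := hr <;> obtain hv1 | hv1 := hv1
        · omega
        · rw [hr, ← this, ← hv1, h0]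
        · rw [hr, this, ← hv1, h0]
        · omega
  have hb' := mem_nodes.1 hb
  -- Some row of cells touches `b`; this needs `1 ≤ w`.
  obtain ⟨r, hr0, hrw, hr⟩ : ∃ r : ℤ, 0 ≤ r ∧ r < w ∧ (r = b.2 ∨ r = b.2 - 1) := by
    by_cases h : b.2 = 0
    · exact ⟨0, by omega⟩
    · exact ⟨b.2 - 1, by omega⟩
  have h1 := (key b hab).2 r hr0 hrw hr
  rw [hbl, hGl r hr0 hrw] at h1
  exact one_ne_zero h1

/-! ### Duality and the reliability identity -/

theorem crossesVertically_sdiff_iff {l w : ℕ} (hw : 1 ≤ w) {i : HammockKind}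
    {C : Finset (ℤ × ℤ)} (hC : C ⊆ cells l w) :
    CrossesVertically l w i.other (cells l w \ C) ↔ ¬ Crosses l w i C :=
  ⟨not_crosses_of_crossesVertically hw hC, (crosses_or_crossesVertically l w i C).resolve_left⟩

lemma cells_image_swap (l w : ℕ) : (cells l w).image Prod.swap = cells w l := by
  ext ⟨x, y⟩
  simp [cells, and_comm]

end Hammock

theorem corollary2 (l w : ℕ) (hl : 1 ≤ l) (hw : 1 ≤ w) (i : HammockKind)
    (p : ℝ) (hp : p ∈ Set.Icc (0 : ℝ) 1) :
    (Hammock.reliability l w i).eval p = 1 - (Hammock.reliability w l i.other).eval (1 - p) := by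
  classical
  open Hammock in
  have hdual : (reliability w l i.other).eval (1 - p) =
      ∑ C ∈ (cells l w).powerset with ¬ Crosses l w i C,
        p ^ C.card * (1 - p) ^ (cells l w \ C).card := by
    rw [reliability_eval]
    symm
    refine Finset.sum_bij (fun C _ => (cells l w \ C).image Prod.swap) ?_ ?_ ?_ ?_
    · intro C hC
      simp only [Finset.mem_filter, Finset.mem_powerset] at hC ⊢
      rw [crosses_image_swap_iff, crossesVertically_sdiff_iff hw hC.1, ← cells_image_swap l w]
      exact ⟨Finset.image_subset_image Finset.sdiff_subset, hC.2⟩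
    · intro C hC C' hC' h
      simp only [Finset.mem_filter, Finset.mem_powerset] at hC hC'
      have h' := Finset.image_injective Prod.swap_injective h
      rw [← Finset.sdiff_sdiff_eq_self hC.1, h', Finset.sdiff_sdiff_eq_self hC'.1]
    · intro P hP
      simp only [Finset.mem_filter, Finset.mem_powerset] at hP
      obtain ⟨h1, h2⟩ := hP
      rw [← cells_image_swap l w, Finset.subset_image_iff] at h1
      obtain ⟨D, hD, rfl⟩ := h1
      have hD' : D ⊆ cells l w := by simpa using hD
      have hDD := Finset.sdiff_sdiff_eq_self hD'
      refine ⟨cells l w \ D, ?_, by rw [hDD]⟩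
      simp only [Finset.mem_filter, Finset.mem_powerset]
      refine ⟨Finset.sdiff_subset, ?_⟩
      rw [← crossesVertically_sdiff_iff hw Finset.sdiff_subset, hDD]
      exact crosses_image_swap_iff.1 h2
    · intro C hC
      simp only [Finset.mem_filter, Finset.mem_powerset] at hC
      rw [← cells_image_swap l w, ← Finset.image_sdiff _ _ Prod.swap_injective,
        Finset.card_image_of_injective _ Prod.swap_injective,
        Finset.card_image_of_injective _ Prod.swap_injective, Finset.sdiff_sdiff_eq_self hC.1,
        sub_sub_cancel, mul_comm]
  rw [hdual, Hammock.reliability_eval, eq_sub_iff_add_eq, Finset.sum_filter_add_sum_filter_not]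
  have := Finset.prod_add (fun _ => p) (fun _ => 1 - p) (Hammock.cells l w)
  simpa using this.symm
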